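/- Manifolds are smooth, finite-dimensional, Hausdorff and second countable (not necessarily connected). A subset $L$ of a manifold $M$ is a \emph{weakly-embedded submanifold} if it carries a manifold structure for which the inclusion $L\hookrightarrow M$ is an immersion and for which a map from an open subset of a Cartesian space $\mathbb{R}^d$ to $L$ is smooth if and only if it is smooth as a map to $M$. A \emph{singular foliation} of $M$ is a partition $\mathcal{F}$ of $M$ into connected weakly-embedded submanifolds, called leaves, such that about each $x\in M$ there is a chart $\psi: V\to U\times W$ of $M$, where $U\subseteq\mathbb{R}^k$ and $W\subseteq\mathbb{R}^{\dim M-k}$ are open neighbourhoods of the origins and $k$ is the dimension of the leaf through $x$, with $\psi(x)=(0,0)$ and such that for each leaf $L$ we have $\psi(L\cap V)=U\times\ell$ for some $\ell\subseteq W$. Write $T\mathcal{F}=\bigcup_{x\in M}T_xL_x\subseteq TM$, where $L_x$ is the leaf through $x$. For a surjective submersion $p:M\to N$ with connected fibers and a singular foliation $\mathcal{G}$ of $N$, the pullback $p^{-1}\mathcal{G}$ is the singular foliation of $M$ with $T(p^{-1}\mathcal{G})=(dp)^{-1}(T\mathcal{G})$, whose leaves are the sets $p^{-1}(L)$, for $L$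 a leaf of $\mathcal{G}$. Two singular foliations $(N_0,\mathcal{F}_0)$ and $(N_1,\mathcal{F}_1)$ are \emph{Molino transverse equivalent} if there are a manifold $M$ with a singular foliation $\mathcal{F}$ and surjective submersions with connected fibers $p_i:M\to N_i$ such that $p_i^{-1}(\mathcal{F}_i)=\mathcal{F}$ for $i=0,1$. \textbf{Proposition.} Molino transverse equivalence is an equivalence relation on singular foliations: it is reflexive, symmetric and transitive. -/

import Mathlib

open scoped Manifold ContDiff

universe u

namespace SingularFol

/-- A smooth manifold: finite-dimensional, without boundary, Hausdorff and second countable.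
It need not be connected and may be empty. -/
structure SmoothMfd : Type (u + 1) where
  /-- The underlying set. -/
  carrier : Type u
  /-- The dimension. -/
  dim : ℕ
  [topologicalSpace : TopologicalSpace carrier]
  [chartedSpace : ChartedSpace (EuclideanSpace ℝ (Fin dim)) carrier]
  [isManifold : IsManifold (𝓡 dim) ∞ carrier]
  [t2Space : T2Space carrier]
  [secondCountable : SecondCountableTopology carrier]

namespace SmoothMfd

instance : CoeSort SmoothMfd.{u} (Type u) := ⟨carrier⟩

attribute [instance] topologicalSpace chartedSpace isManifold t2Space secondCountable

end SmoothMfd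

/-- `ι : X → M` exhibits the subset `L` of `M` as a weakly-embedded submanifold: `ι` is an
injective immersion with image `L` and, after the identification of `X` with `L` through `ι`, the
plots of the manifold `X` (the smooth maps into `X` from open subsets of Cartesian spaces) are
exactly the plots of the subspace diffeology of `L` (the smooth maps into `M` from such subsets,
with values in `L`). -/
structure IsWeakEmbeddingOnto {X M : SmoothMfd.{u}} (ι : X → M) (L : Set M) : Prop where
  range_eq : Set.range ι = L
  injective : Function.Injective ι
  isImmersion : Manifold.IsImmersion (𝓡 X.dim) (𝓡 M.dim) ∞ ι
  plots : ∀ (d : ℕ) (U : Set (EuclideanSpace ℝ (Fin d))), IsOpen U →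
    ∀ f : EuclideanSpace ℝ (Fin d) → X,
      ContMDiffOn (𝓡 d) (𝓡 X.dim) ∞ f U ↔ ContMDiffOn (𝓡 d) (𝓡 M.dim) ∞ (ι ∘ f) U

/-- `L` is a weakly-embedded submanifold of `M` of dimension `k`, connected in its manifold
topology. -/
def IsConnectedWeaklyEmbedded {M : SmoothMfd.{u}} (L : Set M) (k : ℕ) : Prop :=
  ∃ (X : SmoothMfd.{u}) (ι : X → M),
    X.dim = k ∧ ConnectedSpace X ∧ IsWeakEmbeddingOnto ι L

/-- About the point `x` there is a chart of `M`, a diffeomorphism `ψ` from an open set onto a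
product `U × W` of open neighbourhoods of the origins of `ℝᵏ` and `ℝˡ`, `k + l = dim M`, which
sends `x` to `(0, 0)` and in which every member of `leaves` has the form `U × ℓ`. -/
def HasAdaptedChart {M : SmoothMfd.{u}} (leaves : Set (Set M)) (k : ℕ) (x : M) : Prop :=
  ∃ (l : ℕ) (_ : k + l = M.dim)
    (ψ : OpenPartialHomeomorph M (EuclideanSpace ℝ (Fin k) × EuclideanSpace ℝ (Fin l)))
    (U : Set (EuclideanSpace ℝ (Fin k))) (W : Set (EuclideanSpace ℝ (Fin l))),
    ContMDiffOn (𝓡 M.dim) 𝓘(ℝ, EuclideanSpace ℝ (Fin k) × EuclideanSpace ℝ (Fin l)) ∞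
      ψ ψ.source ∧
    ContMDiffOn 𝓘(ℝ, EuclideanSpace ℝ (Fin k) × EuclideanSpace ℝ (Fin l)) (𝓡 M.dim) ∞
      ψ.symm ψ.target ∧
    IsOpen U ∧ IsOpen W ∧ ψ.target = U ×ˢ W ∧
    x ∈ ψ.source ∧ ψ x = (0, 0) ∧
    ∀ L ∈ leaves, ∃ ℓ ⊆ W, ψ '' (L ∩ ψ.source) = U ×ˢ ℓ

/-- A (Stefan) singular foliation of `M`: a partition of `M` into connected, weakly-embedded
submanifolds, such that about each point there is an adapted chart, whose first factor has the
dimension of the leaf through that point. -/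
structure SingularFoliation (M : SmoothMfd.{u}) where
  /-- The leaves. -/
  leaves : Set (Set M)
  isPartition : Setoid.IsPartition leaves
  isLeaf : ∀ L ∈ leaves, ∃ k : ℕ,
    IsConnectedWeaklyEmbedded L k ∧ ∀ x ∈ L, HasAdaptedChart leaves k x

/-- The singular distribution `TF ⊆ TM`, the union of the tangent spaces `T_x L` of the leaves. -/
def SingularFoliation.tangentDistribution {M : SmoothMfd.{u}} (F : SingularFoliation M) :
    Set (TangentBundle (𝓡 M.dim) M) :=
  {v | ∃ L ∈ F.leaves, ∃ (X : SmoothMfd.{u}) (ι : X → M), IsWeakEmbeddingOnto ι L ∧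
    v ∈ Set.range (tangentMap (𝓡 X.dim) (𝓡 M.dim) ι)}

/-- A surjective submersion with connected fibers. -/
structure IsConnectedFiberSubmersion {M N : SmoothMfd.{u}} (p : M → N) : Prop where
  surjective : Function.Surjective p
  isSubmersion : Manifold.IsSubmersion (𝓡 M.dim) (𝓡 N.dim) ∞ p
  isConnected_fiber : ∀ y : N, IsConnected (p ⁻¹' {y})

/-- `F` is the pullback `p⁻¹ G` of the singular foliation `G` along `p`: the singular foliation
with distribution `(dp)⁻¹ (TG)`, whose leaves are the sets `p⁻¹ (L)` with `L` a leaf of `G`. -/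
structure IsPullback {M N : SmoothMfd.{u}} (p : M → N) (G : SingularFoliation N)
    (F : SingularFoliation M) : Prop where
  tangentDistribution_eq :
    F.tangentDistribution =
      tangentMap (𝓡 M.dim) (𝓡 N.dim) p ⁻¹' G.tangentDistribution
  leaves_eq : F.leaves = {S | ∃ L ∈ G.leaves, S = p ⁻¹' L}

/-- A manifold together with a singular foliation of it. -/
structure FoliatedMfd : Type (u + 1) where
  /-- The manifold. -/
  mfd : SmoothMfd.{u}
  /-- The singular foliation. -/
  foliation : SingularFoliation mfd

/-- Molino transverse equivalence of singular foliations. -/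
def MolinoTransverseEquivalent (A B : FoliatedMfd.{u}) : Prop :=
  ∃ (M : FoliatedMfd.{u}) (p : M.mfd → A.mfd) (q : M.mfd → B.mfd),
    IsConnectedFiberSubmersion p ∧ IsConnectedFiberSubmersion q ∧
    IsPullback p A.foliation M.foliation ∧ IsPullback q B.foliation M.foliation

end SingularFol

/-
Only transitivity needs an argument. Given equivalences `A ← M → N ← M' → C`, the fiber product of
`M` and `M'` over `N` projects to `M` and to `M'`, again by surjective submersions with connected
fibers, and the pullbacks to it of the foliations of `A` and of `C` both agree with the pullback of
the foliation of `N`.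

That the preimages `p⁻¹ (L)` of the leaves of a singular foliation under `p : M → N` again form one
also comes from a fiber product: if `ι : X → N` is the inclusion of the leaf `L`, then
`X ×_N M → M` is a weak embedding onto `p⁻¹ (L)`, and `X ×_N M` is connected because the fibers of
its projection to `X` are fibers of `p`. Locally `p` is a projection `N × F → N` and
`X ×_N M → M` is `ι × id : X × F → N × F`.
-/

namespace SingularFol

open Set Topology Manifold

section PartialDiffeo

variable {𝕜 : Type*} [NontriviallyNormedField 𝕜]
  {E E' F F' H H' G G' : Type*}
  [NormedAddCommGroup E] [NormedSpace 𝕜 E] [NormedAddCommGroup E'] [NormedSpace 𝕜 E']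
  [NormedAddCommGroup F] [NormedSpace 𝕜 F] [NormedAddCommGroup F'] [NormedSpace 𝕜 F']
  [TopologicalSpace H] [TopologicalSpace H'] [TopologicalSpace G] [TopologicalSpace G']
  {I : ModelWithCorners 𝕜 E H} {I' : ModelWithCorners 𝕜 E' H'}
  {J : ModelWithCorners 𝕜 F G} {J' : ModelWithCorners 𝕜 F' G'}
  {M M' N N' : Type*}
  [TopologicalSpace M] [ChartedSpace H M] [TopologicalSpace M'] [ChartedSpace H' M']
  [TopologicalSpace N] [ChartedSpace G N] [TopologicalSpace N'] [ChartedSpace G' N']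
  {n : WithTop ℕ∞}

/-- A partial homeomorphism which is `C^n` in both directions: the notion of chart used in all the
local arguments, with values in an arbitrary manifold. Being a predicate on
`OpenPartialHomeomorph`, it inherits the operations on partial homeomorphisms. -/
structure IsPartialDiffeo (I : ModelWithCorners 𝕜 E H) (J : ModelWithCorners 𝕜 F G)
    (n : WithTop ℕ∞) (e : OpenPartialHomeomorph M N) : Prop where
  contMDiffOn : ContMDiffOn I J n e e.source
  contMDiffOn_symm : ContMDiffOn J I n e.symm e.target

/-- The exchange of the last two factors of a triple product. -/
def prodRightComm (𝕜 E F G : Type*) [NontriviallyNormedField 𝕜]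
    [NormedAddCommGroup E] [NormedSpace 𝕜 E] [NormedAddCommGroup F] [NormedSpace 𝕜 F]
    [NormedAddCommGroup G] [NormedSpace 𝕜 G] : ((E × F) × G) ≃L[𝕜] (E × G) × F :=
  ((ContinuousLinearEquiv.prodAssoc 𝕜 E F G).trans
    ((ContinuousLinearEquiv.refl 𝕜 E).prodCongr (.prodComm 𝕜 F G))).trans
      (ContinuousLinearEquiv.prodAssoc 𝕜 E G F).symm

@[simp]
theorem prodRightComm_apply (z : (E × F) × E') :
    prodRightComm 𝕜 E F E' z = ((z.1.1, z.2), z.1.2) :=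
  rfl

namespace IsPartialDiffeo

theorem refl : IsPartialDiffeo I I n (OpenPartialHomeomorph.refl M) :=
  ⟨contMDiffOn_id, contMDiffOn_id⟩

theorem of_diffeomorph (Φ : M ≃ₘ^n⟮I, J⟯ N) :
    IsPartialDiffeo I J n Φ.toHomeomorph.toOpenPartialHomeomorph :=
  ⟨Φ.contMDiff.contMDiffOn, Φ.symm.contMDiff.contMDiffOn⟩

theorem prodAssoc :
    IsPartialDiffeo ((I.prod I').prod J) (I.prod (I'.prod J)) n
      (Homeomorph.prodAssoc M M' N).toOpenPartialHomeomorph where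
  contMDiffOn :=
    (contMDiff_fst.fst.prodMk (contMDiff_fst.snd.prodMk contMDiff_snd)).contMDiffOn
  contMDiffOn_symm :=
    ((contMDiff_fst.prodMk contMDiff_snd.fst).prodMk contMDiff_snd.snd).contMDiffOn

theorem prodRightComm :
    IsPartialDiffeo ((𝓘(𝕜, E).prod 𝓘(𝕜, F)).prod 𝓘(𝕜, E'))
      (𝓘(𝕜, E × E').prod 𝓘(𝕜, F)) n
      (prodRightComm 𝕜 E F E').toHomeomorph.toOpenPartialHomeomorph where
  contMDiffOn :=
    ((contMDiff_fst.fst.prodMk_space contMDiff_snd).prodMk contMDiff_fst.snd).contMDiffOn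
  contMDiffOn_symm :=
    (((contDiff_fst.contMDiff.comp contMDiff_fst).prodMk contMDiff_snd).prodMk
      (contDiff_snd.contMDiff.comp contMDiff_fst)).contMDiffOn

theorem of_mem_maximalAtlas {e : OpenPartialHomeomorph M H}
    (he : e ∈ IsManifold.maximalAtlas I n M) : IsPartialDiffeo I I n e :=
  ⟨contMDiffOn_of_mem_maximalAtlas he, contMDiffOn_symm_of_mem_maximalAtlas he⟩

theorem chartAt [IsManifold I n M] (x : M) : IsPartialDiffeo I I n (chartAt H x) :=
  of_mem_maximalAtlas (IsManifold.chart_mem_maximalAtlas x)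

variable {e : OpenPartialHomeomorph M N}

theorem symm (he : IsPartialDiffeo I J n e) : IsPartialDiffeo J I n e.symm :=
  ⟨he.contMDiffOn_symm, he.contMDiffOn⟩

theorem trans (he : IsPartialDiffeo I J n e) {e' : OpenPartialHomeomorph N N'}
    (he' : IsPartialDiffeo J J' n e') : IsPartialDiffeo I J' n (e.trans e') where
  contMDiffOn := he'.contMDiffOn.comp (he.contMDiffOn.mono inter_subset_left) inter_subset_right
  contMDiffOn_symm :=
    he.contMDiffOn_symm.comp (he'.contMDiffOn_symm.mono inter_subset_left) inter_subset_right

theorem prod (he : IsPartialDiffeo I J n e) {e' : OpenPartialHomeomorph M' N'}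
    (he' : IsPartialDiffeo I' J' n e') :
    IsPartialDiffeo (I.prod I') (J.prod J') n (e.prod e') where
  contMDiffOn := he.contMDiffOn.prodMap he'.contMDiffOn
  contMDiffOn_symm := he.contMDiffOn_symm.prodMap he'.contMDiffOn_symm

theorem restrOpen (he : IsPartialDiffeo I J n e) {s : Set M} (hs : IsOpen s) :
    IsPartialDiffeo I J n (e.restrOpen s hs) where
  contMDiffOn := he.contMDiffOn.mono inter_subset_left
  contMDiffOn_symm := he.contMDiffOn_symm.mono inter_subset_left

theorem contMDiffAt (he : IsPartialDiffeo I J n e) {x : M} (hx : x ∈ e.source) :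
    ContMDiffAt I J n e x :=
  he.contMDiffOn.contMDiffAt (e.open_source.mem_nhds hx)

theorem mem_maximalAtlas [IsManifold I n M] {e : OpenPartialHomeomorph M H}
    (he : IsPartialDiffeo I I n e) : e ∈ IsManifold.maximalAtlas I n M :=
  e.mem_maximalAtlas_of_contMDiffOn he.contMDiffOn he.contMDiffOn_symm

theorem nonempty_continuousLinearEquiv (he : IsPartialDiffeo I J n e) (hn : n ≠ 0) {x : M}
    (hx : x ∈ e.source) : Nonempty (E ≃L[𝕜] F) :=
  let e' : PartialDiffeomorph I J M N n :=
    { e with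
      contMDiffOn_toFun := he.contMDiffOn
      contMDiffOn_invFun := he.contMDiffOn_symm }
  have h : IsLocalDiffeomorphAt I J n e x := ⟨e', hx, fun _ _ ↦ rfl⟩
  ⟨h.mfderivToContinuousLinearEquiv hn⟩

theorem iff_modelWithCornersSelf_prod {e : OpenPartialHomeomorph M (E' × F')} :
    IsPartialDiffeo I (𝓘(𝕜, E').prod 𝓘(𝕜, F')) n e ↔ IsPartialDiffeo I 𝓘(𝕜, E' × F') n e := by
  rw [← modelWithCornersSelf_prod, chartedSpaceSelf_prod]

theorem of_continuousLinearEquiv (L : E ≃L[𝕜] F) :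
    IsPartialDiffeo 𝓘(𝕜, E) 𝓘(𝕜, F) n L.toHomeomorph.toOpenPartialHomeomorph :=
  ⟨L.contDiff.contMDiff.contMDiffOn, L.symm.contDiff.contMDiff.contMDiffOn⟩

theorem of_continuousLinearEquiv_prod (L : E ≃L[𝕜] E' × F') :
    IsPartialDiffeo 𝓘(𝕜, E) (𝓘(𝕜, E').prod 𝓘(𝕜, F')) n
      L.toHomeomorph.toOpenPartialHomeomorph :=
  iff_modelWithCornersSelf_prod.2 (of_continuousLinearEquiv L)

end IsPartialDiffeo

end PartialDiffeo

section ProductChart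

variable {𝕜 : Type*} [NontriviallyNormedField 𝕜] {E E' E'' F F' H H' H'' : Type*}
  [NormedAddCommGroup E] [NormedSpace 𝕜 E] [NormedAddCommGroup E'] [NormedSpace 𝕜 E']
  [NormedAddCommGroup E''] [NormedSpace 𝕜 E''] [NormedAddCommGroup F] [NormedSpace 𝕜 F]
  [NormedAddCommGroup F'] [NormedSpace 𝕜 F']
  [TopologicalSpace H] [TopologicalSpace H'] [TopologicalSpace H'']
  {I : ModelWithCorners 𝕜 E H} {I' : ModelWithCorners 𝕜 E' H'} {I'' : ModelWithCorners 𝕜 E'' H''}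
  {n : WithTop ℕ∞} {M N K : Type*} [TopologicalSpace M] [ChartedSpace H M]
  [TopologicalSpace N] [ChartedSpace H' N] [TopologicalSpace K] [ChartedSpace H'' K]
  {p : M → N} {q : N → K}

/-- A partial diffeomorphism of the form `m ↦ (p m, s m)`, which turns `p` into the projection of
the product `N × F`. In contrast with the charts of `Manifold.IsSubmersionAtOfComplement`, its
values keep the points of `N` itself as their first coordinate, so that it can be base changed along
a map to `N`. -/
structure IsProductChart (I : ModelWithCorners 𝕜 E H) (I' : ModelWithCorners 𝕜 E' H')
    (n : WithTop ℕ∞) (p : M → N) (e : OpenPartialHomeomorph M (N × F)) : Prop where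
  isPartialDiffeo : IsPartialDiffeo I (I'.prod 𝓘(𝕜, F)) n e
  fst_apply : ∀ m ∈ e.source, (e m).1 = p m

namespace IsProductChart

variable {e : OpenPartialHomeomorph M (N × F)}

theorem apply_symm (he : IsProductChart I I' n p e) {z : N × F} (hz : z ∈ e.target) :
    p (e.symm z) = z.1 := by
  rw [← he.fst_apply _ (e.map_target hz), e.right_inv hz]

theorem eventuallyEq (he : IsProductChart I I' n p e) {m : M} (hm : m ∈ e.source) :
    p =ᶠ[𝓝 m] Prod.fst ∘ e :=
  Filter.eventuallyEq_of_mem (e.open_source.mem_nhds hm) fun m' hm' ↦ (he.fst_apply m' hm').symm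

theorem map_nhds_eq (he : IsProductChart I I' n p e) {m : M} (hm : m ∈ e.source) :
    Filter.map p (𝓝 m) = 𝓝 (p m) := by
  rw [Filter.map_congr (he.eventuallyEq hm), ← Filter.map_map, e.map_nhds_eq hm, map_fst_nhds,
    he.fst_apply m hm]

theorem of_diffeomorph (Φ : M ≃ₘ^n⟮I, I'⟯ N) :
    IsProductChart (F := PUnit) I I' n Φ
      (Φ.toHomeomorph.trans (Homeomorph.prodPUnit N).symm).toOpenPartialHomeomorph where
  isPartialDiffeo :=
    ⟨(Φ.contMDiff.prodMk contMDiff_const).contMDiffOn,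
      (Φ.symm.contMDiff.comp contMDiff_fst).contMDiffOn⟩
  fst_apply _ _ := rfl

theorem comp (he : IsProductChart I I' n p e) {e' : OpenPartialHomeomorph N (K × F')}
    (he' : IsProductChart I' I'' n q e') :
    IsProductChart I I'' n (q ∘ p) ((e.trans (e'.prod (.refl F))).trans
      (Homeomorph.prodAssoc K F' F).toOpenPartialHomeomorph) where
  isPartialDiffeo := by
    have := (he.isPartialDiffeo.trans (he'.isPartialDiffeo.prod .refl)).trans .prodAssoc
    rwa [← modelWithCornersSelf_prod, chartedSpaceSelf_prod] at this
  fst_apply m hm := by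
    have hm' : m ∈ e.source ∧ (e m).1 ∈ e'.source := by simpa using hm
    exact (he'.fst_apply _ hm'.2).trans (congrArg q (he.fst_apply m hm'.1))

end IsProductChart

end ProductChart

section Submersion

variable {𝕜 : Type*} [NontriviallyNormedField 𝕜] {E E' E'' F F' : Type*}
  [NormedAddCommGroup E] [NormedSpace 𝕜 E] [NormedAddCommGroup E'] [NormedSpace 𝕜 E']
  [NormedAddCommGroup E''] [NormedSpace 𝕜 E''] [NormedAddCommGroup F] [NormedSpace 𝕜 F]
  [NormedAddCommGroup F'] [NormedSpace 𝕜 F']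
  {n : WithTop ℕ∞} {M N K : Type*} [TopologicalSpace M] [ChartedSpace E M]
  [TopologicalSpace N] [ChartedSpace E' N] [TopologicalSpace K] [ChartedSpace E'' K]
  {p : M → N} {q : N → K}

theorem exists_isProductChart {m : M}
    (hp : IsSubmersionAtOfComplement F 𝓘(𝕜, E) 𝓘(𝕜, E') n p m) :
    ∃ e : OpenPartialHomeomorph M (N × F),
      IsProductChart 𝓘(𝕜, E) 𝓘(𝕜, E') n p e ∧ m ∈ e.source := by
  have hchart : ∀ m' ∈ hp.domChart.source,
      hp.codChart (p m') = (hp.equiv (hp.domChart m')).1 := by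
    intro m' hm'
    have hm'' : hp.domChart m' ∈ (hp.domChart.extend 𝓘(𝕜, E)).target := by
      simpa using hp.domChart.map_source hm'
    simpa [hm'] using hp.writtenInCharts hm''
  let e := (hp.domChart.trans hp.equiv.toHomeomorph.toOpenPartialHomeomorph).trans
    (hp.codChart.symm.prod (.refl F))
  refine ⟨e, ⟨((IsPartialDiffeo.of_mem_maximalAtlas hp.domChart_mem_maximalAtlas).trans
      (.of_continuousLinearEquiv_prod _)).trans
      ((IsPartialDiffeo.of_mem_maximalAtlas hp.codChart_mem_maximalAtlas).symm.prod .refl),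
    fun m' hm' ↦ ?_⟩, ?_⟩
  · have hm'' : m' ∈ hp.domChart.source := hm'.1.1
    simp [e, ← hchart m' hm'', hp.codChart.left_inv (hp.source_subset_preimage_source hm'')]
  · simpa [e, hp.mem_domChart_source, ← hchart m hp.mem_domChart_source] using
      hp.codChart.map_source hp.mem_codChart_source

theorem IsProductChart.isSubmersionAtOfComplement [IsManifold 𝓘(𝕜, E) n M]
    [IsManifold 𝓘(𝕜, E') n N] (hn : n ≠ 0) {e : OpenPartialHomeomorph M (N × F)}
    (he : IsProductChart 𝓘(𝕜, E) 𝓘(𝕜, E') n p e) {m : M} (hm : m ∈ e.source) :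
    IsSubmersionAtOfComplement F 𝓘(𝕜, E) 𝓘(𝕜, E') n p m := by
  obtain ⟨L⟩ := he.isPartialDiffeo.nonempty_continuousLinearEquiv hn hm
  let φ := chartAt E' (p m)
  have hdom := (he.isPartialDiffeo.trans ((IsPartialDiffeo.chartAt (p m)).prod .refl)).trans
    (IsPartialDiffeo.of_continuousLinearEquiv_prod L).symm
  refine .mk_of_continuousAt (he.map_nhds_eq hm).le L _ φ ?_
    (mem_chart_source _ _) hdom.mem_maximalAtlas (IsManifold.chart_mem_maximalAtlas _) ?_
  · simpa [he.fst_apply m hm] using hm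
  · intro z hz
    have hz' : (φ.symm (L z).1, (L z).2) ∈ e.target ∧ (L z).1 ∈ φ.target := by
      simpa [φ, and_comm] using hz
    simp [he.apply_symm hz'.1, φ, φ.right_inv hz'.2]

theorem isSubmersionOfComplement_comp [IsManifold 𝓘(𝕜, E) n M] [IsManifold 𝓘(𝕜, E'') n K]
    (hn : n ≠ 0) (hq : IsSubmersionOfComplement F' 𝓘(𝕜, E') 𝓘(𝕜, E'') n q)
    (hp : IsSubmersionOfComplement F 𝓘(𝕜, E) 𝓘(𝕜, E') n p) :
    IsSubmersionOfComplement (F' × F) 𝓘(𝕜, E) 𝓘(𝕜, E'') n (q ∘ p) := fun m ↦ by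
  obtain ⟨e, he, hm⟩ := exists_isProductChart (hp m)
  obtain ⟨e', he', hm'⟩ := exists_isProductChart (hq (p m))
  rw [← he.fst_apply m hm] at hm'
  exact (he.comp he').isSubmersionAtOfComplement hn (by simpa using ⟨hm, hm'⟩)

theorem isOpenMap_of_isSubmersionOfComplement
    (hp : IsSubmersionOfComplement F 𝓘(𝕜, E) 𝓘(𝕜, E') n p) : IsOpenMap p :=
  IsOpenMap.of_nhds_le fun m ↦ by
    obtain ⟨e, he, hm⟩ := exists_isProductChart (hp m)
    exact (he.map_nhds_eq hm).ge

end Submersion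

section SubmanifoldChart

variable {𝕜 : Type*} [NontriviallyNormedField 𝕜] {E E' F F' H H' G G' : Type*}
  [NormedAddCommGroup E] [NormedSpace 𝕜 E] [NormedAddCommGroup E'] [NormedSpace 𝕜 E']
  [NormedAddCommGroup F] [NormedSpace 𝕜 F] [NormedAddCommGroup F'] [NormedSpace 𝕜 F']
  [TopologicalSpace H] [TopologicalSpace H'] [TopologicalSpace G] [TopologicalSpace G']
  {I : ModelWithCorners 𝕜 E H} {I' : ModelWithCorners 𝕜 E' H'}
  {J : ModelWithCorners 𝕜 F G} {J' : ModelWithCorners 𝕜 F' G'} {n : WithTop ℕ∞}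
  {T Y Y' Z W : Type*} [TopologicalSpace T] [TopologicalSpace Y] [ChartedSpace H Y]
  [TopologicalSpace Y'] [ChartedSpace H' Y'] [TopologicalSpace Z] [ChartedSpace G Z]
  [TopologicalSpace W] [ChartedSpace G' W] {i : T → Z}

/-- A chart `e` of the topological space `T` which is adapted to the map `i` from `T` to a manifold:
it is the restriction along `i` of a `C^n` map `r`, and `i` is `C^n` in this chart. Such charts are
automatically compatible with each other and make `T` a submanifold. -/
structure IsSubmanifoldChart (J : ModelWithCorners 𝕜 F G) (I : ModelWithCorners 𝕜 E H)
    (n : WithTop ℕ∞) (i : T → Z) (e : OpenPartialHomeomorph T Y) : Prop where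
  exists_extension : ∃ r : Z → Y, ContMDiffOn J I n r (i '' e.source) ∧ EqOn (r ∘ i) e e.source
  contMDiffOn_comp_symm : ContMDiffOn I J n (i ∘ e.symm) e.target

theorem IsSubmanifoldChart.contMDiffOn_comp {e : OpenPartialHomeomorph T Y}
    (he : IsSubmanifoldChart J I n i e) {g : W → T} {s : Set W}
    (hg : ContMDiffOn J' J n (i ∘ g) s) (hs : MapsTo g s e.source) :
    ContMDiffOn J' I n (e ∘ g) s := by
  obtain ⟨r, hr, hri⟩ := he.exists_extension
  exact (hr.comp hg fun w hw ↦ mem_image_of_mem i (hs hw)).congr fun w hw ↦ (hri (hs hw)).symm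

theorem IsSubmanifoldChart.trans {e : OpenPartialHomeomorph T Y}
    (he : IsSubmanifoldChart J I n i e) {φ : OpenPartialHomeomorph Y Y'}
    (hφ : IsPartialDiffeo I I' n φ) : IsSubmanifoldChart J I' n i (e.trans φ) where
  exists_extension := by
    obtain ⟨r, hr, hri⟩ := he.exists_extension
    refine ⟨φ ∘ r, hφ.contMDiffOn.comp (hr.mono (image_mono inter_subset_left)) ?_,
      fun t ht ↦ congrArg φ (hri ht.1)⟩
    rintro _ ⟨t, ht, rfl⟩
    rw [mem_preimage, show r (i t) = e t from hri ht.1]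
    exact ht.2
  contMDiffOn_comp_symm :=
    he.contMDiffOn_comp_symm.comp (hφ.contMDiffOn_symm.mono inter_subset_left) inter_subset_right

/-- The map `i` from a topological space to a manifold has submanifold charts with values in `E`
about every point: the data which make its source a manifold modelled on `E`. -/
def HasSubmanifoldCharts (J : ModelWithCorners 𝕜 F G) (E : Type*) [NormedAddCommGroup E]
    [NormedSpace 𝕜 E] (n : WithTop ℕ∞) (i : T → Z) : Prop :=
  ∀ t, ∃ e : OpenPartialHomeomorph T E, IsSubmanifoldChart J 𝓘(𝕜, E) n i e ∧ t ∈ e.source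

namespace HasSubmanifoldCharts

/-- The charted space structure given by a choice of a submanifold chart about each point. -/
@[reducible]
noncomputable def chartedSpace (h : HasSubmanifoldCharts J E n i) : ChartedSpace E T where
  atlas := range fun t ↦ (h t).choose
  chartAt t := (h t).choose
  mem_chart_source t := (h t).choose_spec.2
  chart_mem_atlas := mem_range_self

variable (h : HasSubmanifoldCharts J E n i)
include h

theorem isSubmanifoldChart_chartAt (t : T) :
    letI := h.chartedSpace
    IsSubmanifoldChart J 𝓘(𝕜, E) n i (chartAt E t) :=
  (h t).choose_spec.1

theorem isManifold :
    letI := h.chartedSpace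
    IsManifold 𝓘(𝕜, E) n T := by
  let := h.chartedSpace
  refine isManifold_of_contDiffOn _ _ _ ?_
  rintro _ _ ⟨t, rfl⟩ ⟨t', rfl⟩
  have : ContMDiffOn 𝓘(𝕜, E) 𝓘(𝕜, E) n ((h t').choose ∘ (h t).choose.symm)
      ((h t).choose.symm.trans (h t').choose).source :=
    (h t').choose_spec.1.contMDiffOn_comp
      ((h t).choose_spec.1.contMDiffOn_comp_symm.mono inter_subset_left) inter_subset_right
  simpa using this.contDiffOn

theorem contMDiff :
    letI := h.chartedSpace
    ContMDiff 𝓘(𝕜, E) J n i := by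
  let := h.chartedSpace
  have := h.isManifold
  intro t
  have hφ := (IsPartialDiffeo.chartAt (I := 𝓘(𝕜, E)) (n := n) t).contMDiffOn
  refine ((((h.isSubmanifoldChart_chartAt t).contMDiffOn_comp_symm.comp hφ
    (chartAt E t).mapsTo).congr fun t' ht' ↦ ?_).contMDiffAt
      ((chartAt E t).open_source.mem_nhds (mem_chart_source E t)))
  simp [(chartAt E t).left_inv ht']

theorem contMDiffOn_iff (hi : IsInducing i) {g : W → T} {s : Set W} :
    letI := h.chartedSpace
    ContMDiffOn J' 𝓘(𝕜, E) n g s ↔ ContMDiffOn J' J n (i ∘ g) s := by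
  let := h.chartedSpace
  have := h.isManifold
  refine ⟨h.contMDiff.comp_contMDiffOn, fun hg w hw ↦ ?_⟩
  let φ := chartAt E (g w)
  have hs : s ∩ g ⁻¹' φ.source ∈ 𝓝[s] w :=
    Filter.inter_mem self_mem_nhdsWithin <| (hi.continuousOn_iff.2 hg.continuousOn) w hw <|
      φ.open_source.mem_nhds (mem_chart_source E (g w))
  have hφg : ContMDiffOn J' 𝓘(𝕜, E) n (φ ∘ g) (s ∩ g ⁻¹' φ.source) :=
    (h.isSubmanifoldChart_chartAt (g w)).contMDiffOn_comp (hg.mono inter_subset_left)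
      inter_subset_right
  have hg' : ContMDiffOn J' 𝓘(𝕜, E) n g (s ∩ g ⁻¹' φ.source) :=
    ((IsPartialDiffeo.chartAt (g w)).contMDiffOn_symm.comp hφg
      fun w' hw' ↦ φ.map_source hw'.2).congr fun w' hw' ↦ (φ.left_inv hw'.2).symm
  exact (hg' w (mem_of_mem_nhdsWithin hw hs)).mono_of_mem_nhdsWithin hs

theorem isPartialDiffeo (hi : IsInducing i) {e : OpenPartialHomeomorph T Y'}
    (he : IsSubmanifoldChart J I' n i e) :
    letI := h.chartedSpace
    IsPartialDiffeo 𝓘(𝕜, E) I' n e :=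
  letI := h.chartedSpace
  ⟨he.contMDiffOn_comp h.contMDiff.contMDiffOn (mapsTo_id _),
    (h.contMDiffOn_iff hi).2 he.contMDiffOn_comp_symm⟩

end HasSubmanifoldCharts

end SubmanifoldChart

section Immersion

variable {𝕜 : Type*} [NontriviallyNormedField 𝕜] {E₁ E₂ E₃ E₄ V W F G : Type*}
  [NormedAddCommGroup E₁] [NormedSpace 𝕜 E₁] [NormedAddCommGroup E₂] [NormedSpace 𝕜 E₂]
  [NormedAddCommGroup E₃] [NormedSpace 𝕜 E₃] [NormedAddCommGroup E₄] [NormedSpace 𝕜 E₄]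
  [NormedAddCommGroup V] [NormedSpace 𝕜 V] [NormedAddCommGroup W] [NormedSpace 𝕜 W]
  [NormedAddCommGroup F] [NormedSpace 𝕜 F] [NormedAddCommGroup G] [NormedSpace 𝕜 G]
  {n : WithTop ℕ∞} {M₁ M₂ M₃ M₄ : Type*} [TopologicalSpace M₁] [ChartedSpace E₁ M₁]
  [TopologicalSpace M₂] [ChartedSpace E₂ M₂] [TopologicalSpace M₃] [ChartedSpace E₃ M₃]
  [TopologicalSpace M₄] [ChartedSpace E₄ M₄]
  [IsManifold 𝓘(𝕜, E₃) n M₃] [IsManifold 𝓘(𝕜, E₄) n M₄]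

theorem isImmersionAtOfComplement_of_eqOn (hn : n ≠ 0) {g : M₃ → M₄} (equiv : (V × F) ≃L[𝕜] W)
    {α : OpenPartialHomeomorph M₃ V} (hα : IsPartialDiffeo 𝓘(𝕜, E₃) 𝓘(𝕜, V) n α)
    {β : OpenPartialHomeomorph M₄ W} (hβ : IsPartialDiffeo 𝓘(𝕜, E₄) 𝓘(𝕜, W) n β)
    (hg : MapsTo g α.source β.source)
    (hαβ : EqOn (β ∘ g) (fun y ↦ equiv (α y, 0)) α.source) {x : M₃} (hx : x ∈ α.source) :
    IsImmersionAtOfComplement F 𝓘(𝕜, E₃) 𝓘(𝕜, E₄) n g x := by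
  obtain ⟨L⟩ := hα.nonempty_continuousLinearEquiv hn hx
  obtain ⟨L'⟩ := hβ.nonempty_continuousLinearEquiv hn (hg hx)
  refine .mk_of_charts (((L.prodCongr (.refl 𝕜 F)).trans equiv).trans L'.symm)
    (α.trans L.toHomeomorph.toOpenPartialHomeomorph.symm)
    (β.trans L'.toHomeomorph.toOpenPartialHomeomorph.symm)
    (by simpa using hx) (by simpa using hg hx)
    (hα.trans (IsPartialDiffeo.of_continuousLinearEquiv L).symm).mem_maximalAtlas
    (hβ.trans (IsPartialDiffeo.of_continuousLinearEquiv L').symm).mem_maximalAtlas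
    (fun y hy ↦ by simpa using hg (show y ∈ α.source by simpa using hy)) fun z hz ↦ ?_
  have hz' : L z ∈ α.target := by simpa using hz
  have hgz : β (g (α.symm (L z))) = equiv (L z, 0) := by
    simpa [α.right_inv hz'] using hαβ (α.map_target hz')
  simp [hgz]

theorem isImmersionAtOfComplement_of_eqOn_prodMap_id (hn : n ≠ 0) {f : M₁ → M₂} {g : M₃ → M₄}
    {α : OpenPartialHomeomorph M₃ (M₁ × G)} {β : OpenPartialHomeomorph M₄ (M₂ × G)}
    (hα : IsPartialDiffeo 𝓘(𝕜, E₃) (𝓘(𝕜, E₁).prod 𝓘(𝕜, G)) n α)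
    (hβ : IsPartialDiffeo 𝓘(𝕜, E₄) (𝓘(𝕜, E₂).prod 𝓘(𝕜, G)) n β)
    (hg : MapsTo g α.source β.source) (hfg : EqOn (β ∘ g) (Prod.map f id ∘ α) α.source)
    {x : M₃} (hx : x ∈ α.source)
    (hf : IsImmersionAtOfComplement F 𝓘(𝕜, E₁) 𝓘(𝕜, E₂) n f (α x).1) :
    IsImmersionAtOfComplement F 𝓘(𝕜, E₃) 𝓘(𝕜, E₄) n g x := by
  let φ := hf.domChart
  let ψ := hf.codChart
  have hφ := IsPartialDiffeo.of_mem_maximalAtlas hf.domChart_mem_maximalAtlas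
  have hψ := IsPartialDiffeo.of_mem_maximalAtlas hf.codChart_mem_maximalAtlas
  have hβg : ∀ y ∈ α.source, β (g y) = (f (α y).1, (α y).2) := hfg
  have hchart : ∀ y ∈ φ.source, ψ (f y) = hf.equiv (φ y, 0) := fun y hy ↦ by
    have hy' : φ y ∈ (hf.domChart.extend 𝓘(𝕜, E₁)).target := by simpa [φ] using φ.map_source hy
    simpa [φ, ψ, φ.left_inv hy, show y ∈ hf.domChart.source from hy] using hf.writtenInCharts hy'
  let equiv : ((E₁ × G) × F) ≃L[𝕜] E₂ × G :=
    (prodRightComm 𝕜 E₁ G F).trans (hf.equiv.prodCongr (.refl 𝕜 G))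
  have hsource : ∀ y ∈ (α.trans (φ.prod (.refl G))).source, y ∈ α.source ∧ (α y).1 ∈ φ.source :=
    fun y hy ↦ by simpa using hy
  refine isImmersionAtOfComplement_of_eqOn hn equiv
    (α := α.trans (φ.prod (.refl G))) (β := β.trans (ψ.prod (.refl G)))
    (.iff_modelWithCornersSelf_prod.1 (hα.trans (hφ.prod .refl)))
    (.iff_modelWithCornersSelf_prod.1 (hβ.trans (hψ.prod .refl))) (fun y hy ↦ ?_) (fun y hy ↦ ?_) ?_
  · obtain ⟨hyα, hyφ⟩ := hsource y hy
    simpa [hβg y hyα] using ⟨hg hyα, hf.source_subset_preimage_source hyφ⟩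
  · obtain ⟨hyα, hyφ⟩ := hsource y hy
    simp [hβg y hyα, hchart _ hyφ, equiv]
  · simpa using ⟨hx, hf.mem_domChart_source⟩

end Immersion

section FiberProduct

open Function.Pullback

variable {𝕜 : Type*} [NontriviallyNormedField 𝕜] {E E' E'' F V : Type*}
  [NormedAddCommGroup E] [NormedSpace 𝕜 E] [NormedAddCommGroup E'] [NormedSpace 𝕜 E']
  [NormedAddCommGroup E''] [NormedSpace 𝕜 E''] [NormedAddCommGroup F] [NormedSpace 𝕜 F]
  [NormedAddCommGroup V] [NormedSpace 𝕜 V] {n : WithTop ℕ∞} {M N X : Type*}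
  [TopologicalSpace M] [ChartedSpace E M] [TopologicalSpace N] [ChartedSpace E' N]
  {f : X → N} {p : M → N} {e : OpenPartialHomeomorph M (N × F)}

theorem IsProductChart.mk_fst_snd_apply (he : IsProductChart 𝓘(𝕜, E) 𝓘(𝕜, E') n p e)
    {q : f.Pullback p} (hq : q.snd ∈ e.source) : (f q.fst, (e q.snd).2) = e q.snd :=
  Prod.ext (q.2.trans (he.fst_apply _ hq).symm) rfl

variable [TopologicalSpace X]

/-- The partial homeomorphism `(x, m) ↦ (x, s m)` of a fiber product `X ×_N M` with `X × F`, where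
`m ↦ (p m, s m)` is a product chart of the map `p` from `M` to `N`. The inverse involves a junk
value outside the target, hence the nonemptiness assumption. -/
noncomputable def baseChange [Nonempty (f.Pullback p)] (hf : Continuous f)
    (he : IsProductChart 𝓘(𝕜, E) 𝓘(𝕜, E') n p e) :
    OpenPartialHomeomorph (f.Pullback p) (X × F) :=
  have hf' : Continuous fun z : X × F ↦ (f z.1, z.2) := hf.prodMap continuous_id
  have hval {z : X × F} (hz : (f z.1, z.2) ∈ e.target) :
      (Function.invFun Subtype.val (z.1, e.symm (f z.1, z.2)) : f.Pullback p).1 =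
        (z.1, e.symm (f z.1, z.2)) :=
    Function.invFun_eq ⟨⟨_, (he.apply_symm hz).symm⟩, rfl⟩
  { toFun q := (q.fst, (e q.snd).2)
    invFun z := Function.invFun Subtype.val (z.1, e.symm (f z.1, z.2))
    source := snd ⁻¹' e.source
    target := {z | (f z.1, z.2) ∈ e.target}
    map_source' q hq := by
      simpa only [mem_ofPred_eq, he.mk_fst_snd_apply hq] using e.map_source hq
    map_target' z hz := by
      simpa only [mem_preimage, snd, hval hz] using e.map_target hz
    left_inv' q hq := by
      rw [he.mk_fst_snd_apply hq, e.left_inv hq]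
      exact Function.leftInverse_invFun Subtype.val_injective q
    right_inv' z hz := by
      simp only [fst, snd, hval hz, e.right_inv hz]
    open_source := e.open_source.preimage (continuous_snd.comp continuous_subtype_val)
    open_target := e.open_target.preimage hf'
    continuousOn_toFun :=
      (continuous_fst.comp continuous_subtype_val).continuousOn.prodMk <|
        (continuous_snd.comp_continuousOn e.continuousOn).comp
          (continuous_snd.comp continuous_subtype_val).continuousOn (mapsTo_preimage _ _)
    continuousOn_invFun := IsInducing.subtypeVal.continuousOn_iff.2 <|
      (continuousOn_fst.prodMk (e.continuousOn_symm.comp hf'.continuousOn fun _ ↦ id)).congr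
        fun _ ↦ hval }

section

variable [Nonempty (f.Pullback p)]

theorem coe_baseChange_symm (hf : Continuous f) (he : IsProductChart 𝓘(𝕜, E) 𝓘(𝕜, E') n p e)
    {z : X × F} (hz : (f z.1, z.2) ∈ e.target) :
    ((baseChange hf he).symm z : X × M) = (z.1, e.symm (f z.1, z.2)) :=
  Function.invFun_eq ⟨(⟨_, (he.apply_symm hz).symm⟩ : f.Pullback p), rfl⟩

theorem eqOn_comp_snd_baseChange (hf : Continuous f)
    (he : IsProductChart 𝓘(𝕜, E) 𝓘(𝕜, E') n p e) :
    EqOn (e ∘ snd) (Prod.map f id ∘ baseChange hf he) (baseChange hf he).source :=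
  fun _ hq ↦ (he.mk_fst_snd_apply hq).symm

variable [ChartedSpace E'' X]

theorem isSubmanifoldChart_baseChange (hf : ContMDiff 𝓘(𝕜, E'') 𝓘(𝕜, E') n f)
    (he : IsProductChart 𝓘(𝕜, E) 𝓘(𝕜, E') n p e) :
    IsSubmanifoldChart (𝓘(𝕜, E'').prod 𝓘(𝕜, E)) (𝓘(𝕜, E'').prod 𝓘(𝕜, F)) n
      (Subtype.val : f.Pullback p → X × M) (baseChange hf.continuous he) where
  exists_extension := by
    refine ⟨fun z ↦ (z.1, (e z.2).2), contMDiffOn_fst.prodMk (contMDiff_snd.comp_contMDiffOn <|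
      he.isPartialDiffeo.contMDiffOn.comp contMDiffOn_snd ?_), fun _ _ ↦ rfl⟩
    rintro _ ⟨q, hq, rfl⟩
    exact hq
  contMDiffOn_comp_symm :=
    (contMDiffOn_fst.prodMk <| he.isPartialDiffeo.contMDiffOn_symm.comp
      (hf.prodMap contMDiff_id).contMDiffOn fun _ ↦ id).congr
        fun _ ↦ coe_baseChange_symm hf.continuous he

end

theorem hasSubmanifoldCharts_pullback [ChartedSpace E'' X] [IsManifold 𝓘(𝕜, E'') n X]
    (hf : ContMDiff 𝓘(𝕜, E'') 𝓘(𝕜, E') n f)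
    (hp : IsSubmersionOfComplement F 𝓘(𝕜, E) 𝓘(𝕜, E') n p) (L : V ≃L[𝕜] E'' × F) :
    HasSubmanifoldCharts (𝓘(𝕜, E'').prod 𝓘(𝕜, E)) V n
      (Subtype.val : f.Pullback p → X × M) := fun q ↦ by
  obtain ⟨e, he, hq⟩ := exists_isProductChart (hp (snd q))
  have : Nonempty (f.Pullback p) := ⟨q⟩
  refine ⟨_, (isSubmanifoldChart_baseChange hf he).trans (((IsPartialDiffeo.chartAt (fst q)).prod
    .refl).trans (IsPartialDiffeo.of_continuousLinearEquiv_prod L).symm), ?_⟩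
  have hq₁ : q ∈ (baseChange hf.continuous he).source := hq
  have hq₂ : (baseChange hf.continuous he q).1 ∈ (chartAt E'' (fst q)).source :=
    mem_chart_source E'' (fst q)
  simpa using ⟨hq₁, hq₂⟩

end FiberProduct

section FiniteDimensional

variable {𝕜 : Type*} [NontriviallyNormedField 𝕜] [CompleteSpace 𝕜] {E E' F H H' : Type*}
  [NormedAddCommGroup E] [NormedSpace 𝕜 E] [FiniteDimensional 𝕜 E]
  [NormedAddCommGroup E'] [NormedSpace 𝕜 E'] [FiniteDimensional 𝕜 E']
  [NormedAddCommGroup F] [NormedSpace 𝕜 F] [FiniteDimensional 𝕜 F]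
  [TopologicalSpace H] [TopologicalSpace H']
  {I : ModelWithCorners 𝕜 E H} {I' : ModelWithCorners 𝕜 E' H'} {n : WithTop ℕ∞} {M N : Type*}
  [TopologicalSpace M] [ChartedSpace H M] [TopologicalSpace N] [ChartedSpace H' N] {p : M → N}

theorem isSubmersionOfComplement_of_finrank_eq (hp : IsSubmersion I I' n p)
    (hF : Module.finrank 𝕜 F = Module.finrank 𝕜 E - Module.finrank 𝕜 E') :
    IsSubmersionOfComplement F I I' n p := fun m ↦ by
  have hm := hp.isSubmersionOfComplement_complement m
  have : FiniteDimensional 𝕜 (E' × hp.complement) := hm.equiv.toLinearEquiv.finiteDimensional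
  have : FiniteDimensional 𝕜 hp.complement :=
    .of_injective (LinearMap.inr 𝕜 E' hp.complement) LinearMap.inr_injective
  have hE := hm.equiv.toLinearEquiv.finrank_eq
  rw [Module.finrank_prod] at hE
  exact hm.trans_F (.ofFinrankEq (by omega))

end FiniteDimensional

section FiberProduct

variable {X M N : SmoothMfd.{u}} {f : X → N} {p : M → N}

theorem isSubmersionOfComplement_euclideanSpace (hp : IsSubmersion (𝓡 M.dim) (𝓡 N.dim) ∞ p) :
    IsSubmersionOfComplement (EuclideanSpace ℝ (Fin (M.dim - N.dim)))
      (𝓡 M.dim) (𝓡 N.dim) ∞ p :=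
  isSubmersionOfComplement_of_finrank_eq hp (by simp)

theorem hasSubmanifoldCharts_fiberProduct (hf : ContMDiff (𝓡 X.dim) (𝓡 N.dim) ∞ f)
    (hp : IsSubmersion (𝓡 M.dim) (𝓡 N.dim) ∞ p) :
    HasSubmanifoldCharts ((𝓡 X.dim).prod (𝓡 M.dim))
      (EuclideanSpace ℝ (Fin (X.dim + (M.dim - N.dim)))) ∞
      (Subtype.val : f.Pullback p → X × M) :=
  hasSubmanifoldCharts_pullback hf (isSubmersionOfComplement_euclideanSpace hp)
    (.ofFinrankEq (by simp))

/-- The fiber product `X ×_N M` of a smooth map and a submersion, as a manifold. -/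
noncomputable def fiberProduct (hf : ContMDiff (𝓡 X.dim) (𝓡 N.dim) ∞ f)
    (hp : IsSubmersion (𝓡 M.dim) (𝓡 N.dim) ∞ p) : SmoothMfd.{u} where
  carrier := f.Pullback p
  dim := X.dim + (M.dim - N.dim)
  chartedSpace := (hasSubmanifoldCharts_fiberProduct hf hp).chartedSpace
  isManifold := (hasSubmanifoldCharts_fiberProduct hf hp).isManifold
  secondCountable := TopologicalSpace.Subtype.secondCountableTopology _

namespace fiberProduct

section

variable (hf : ContMDiff (𝓡 X.dim) (𝓡 N.dim) ∞ f) (hp : IsSubmersion (𝓡 M.dim) (𝓡 N.dim) ∞ p)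

/-- The projection of the fiber product `X ×_N M` to `X`. -/
def fst : fiberProduct hf hp → X := Function.Pullback.fst

/-- The projection of the fiber product `X ×_N M` to `M`. -/
def snd : fiberProduct hf hp → M := Function.Pullback.snd

theorem comp_fst : f ∘ fst hf hp = p ∘ snd hf hp :=
  Function.pullback_comm_sq f p

theorem contMDiff_fst : ContMDiff (𝓡 (fiberProduct hf hp).dim) (𝓡 X.dim) ∞ (fst hf hp) :=
  letI := (hasSubmanifoldCharts_fiberProduct hf hp).chartedSpace
  (hasSubmanifoldCharts_fiberProduct hf hp).contMDiff.fst

theorem contMDiff_snd : ContMDiff (𝓡 (fiberProduct hf hp).dim) (𝓡 M.dim) ∞ (snd hf hp) :=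
  letI := (hasSubmanifoldCharts_fiberProduct hf hp).chartedSpace
  (hasSubmanifoldCharts_fiberProduct hf hp).contMDiff.snd

variable {E H Z : Type*} [NormedAddCommGroup E] [NormedSpace ℝ E] [TopologicalSpace H]
  {I : ModelWithCorners ℝ E H} [TopologicalSpace Z] [ChartedSpace H Z]

theorem contMDiffOn_iff {g : Z → fiberProduct hf hp} {s : Set Z} :
    ContMDiffOn I (𝓡 (fiberProduct hf hp).dim) ∞ g s ↔
      ContMDiffOn I (𝓡 X.dim) ∞ (fst hf hp ∘ g) s ∧ ContMDiffOn I (𝓡 M.dim) ∞ (snd hf hp ∘ g) s :=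
  ((hasSubmanifoldCharts_fiberProduct hf hp).contMDiffOn_iff .subtypeVal).trans
    (contMDiffOn_prod_iff _)

theorem contMDiff_iff {g : Z → fiberProduct hf hp} :
    ContMDiff I (𝓡 (fiberProduct hf hp).dim) ∞ g ↔
      ContMDiff I (𝓡 X.dim) ∞ (fst hf hp ∘ g) ∧ ContMDiff I (𝓡 M.dim) ∞ (snd hf hp ∘ g) := by
  simp only [← contMDiffOn_univ, contMDiffOn_iff]

end

section

variable {hf : ContMDiff (𝓡 X.dim) (𝓡 N.dim) ∞ f} {hp : IsSubmersion (𝓡 M.dim) (𝓡 N.dim) ∞ p}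
  {F : Type*} [NormedAddCommGroup F] [NormedSpace ℝ F]

theorem exists_isProductChart_fst {e : OpenPartialHomeomorph M (N × F)}
    (he : IsProductChart (𝓡 M.dim) (𝓡 N.dim) ∞ p e) {q : fiberProduct hf hp}
    (hq : snd hf hp q ∈ e.source) :
    ∃ b : OpenPartialHomeomorph (fiberProduct hf hp) (X × F),
      IsProductChart (𝓡 (fiberProduct hf hp).dim) (𝓡 X.dim) ∞ (fst hf hp) b ∧ q ∈ b.source ∧
      MapsTo (snd hf hp) b.source e.source ∧
      EqOn (e ∘ snd hf hp) (Prod.map f id ∘ b) b.source :=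
  have : Nonempty (f.Pullback p) := ⟨q⟩
  ⟨baseChange hf.continuous he,
    ⟨(hasSubmanifoldCharts_fiberProduct hf hp).isPartialDiffeo .subtypeVal
      (isSubmanifoldChart_baseChange hf he), fun _ _ ↦ rfl⟩,
    hq, fun _ ↦ id, eqOn_comp_snd_baseChange hf.continuous he⟩

theorem isSubmersionOfComplement_fst (hpF : IsSubmersionOfComplement F (𝓡 M.dim) (𝓡 N.dim) ∞ p) :
    IsSubmersionOfComplement F (𝓡 (fiberProduct hf hp).dim) (𝓡 X.dim) ∞ (fst hf hp) := fun q ↦ by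
  obtain ⟨e, he, hq⟩ := exists_isProductChart (hpF (snd hf hp q))
  obtain ⟨b, hb, hqb, -⟩ := exists_isProductChart_fst he hq
  exact hb.isSubmersionAtOfComplement (by simp) hqb

theorem isImmersionOfComplement_snd
    (hfF : IsImmersionOfComplement F (𝓡 X.dim) (𝓡 N.dim) ∞ f) :
    IsImmersionOfComplement F (𝓡 (fiberProduct hf hp).dim) (𝓡 M.dim) ∞ (snd hf hp) := fun q ↦ by
  obtain ⟨e, he, hq⟩ :=
    exists_isProductChart (isSubmersionOfComplement_euclideanSpace hp (snd hf hp q))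
  obtain ⟨b, hb, hqb, hbe, heq⟩ := exists_isProductChart_fst he hq
  exact isImmersionAtOfComplement_of_eqOn_prodMap_id (by simp) hb.isPartialDiffeo
    he.isPartialDiffeo hbe heq hqb (hfF _)

end

end fiberProduct

end FiberProduct

section ConnectedFibers

variable {P M N X : SmoothMfd.{u}} {r : P → M} {p : M → N} {f : X → N}

namespace IsConnectedFiberSubmersion

theorem contMDiff (hp : IsConnectedFiberSubmersion p) : ContMDiff (𝓡 M.dim) (𝓡 N.dim) ∞ p :=
  hp.isSubmersion.contMDiff

theorem isConnected_preimage (hp : IsConnectedFiberSubmersion p) {s : Set N} (hs : IsConnected s)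
    (hs' : IsClosed s) : IsConnected (p ⁻¹' s) :=
  have hq : IsQuotientMap p :=
    (isOpenMap_of_isSubmersionOfComplement
      hp.isSubmersion.isSubmersionOfComplement_complement).isQuotientMap
        hp.contMDiff.continuous hp.surjective
  hq.isCoinducing.isConnected_preimage_of_isClosed hp.isConnected_fiber hs' hs

protected theorem id : IsConnectedFiberSubmersion (id : M → M) where
  surjective := Function.surjective_id
  isSubmersion := .id
  isConnected_fiber _ := isConnected_singleton

theorem of_diffeomorph (Φ : M ≃ₘ⟮𝓡 M.dim, 𝓡 N.dim⟯ N) : IsConnectedFiberSubmersion Φ where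
  surjective := Φ.surjective
  isSubmersion :=
    IsSubmersionOfComplement.isSubmersion (F := PUnit.{1}) fun m ↦
      (IsProductChart.of_diffeomorph Φ).isSubmersionAtOfComplement (by simp) (mem_univ m)
  isConnected_fiber y := Φ.toHomeomorph.isConnected_preimage.2 isConnected_singleton

theorem comp (hp : IsConnectedFiberSubmersion p) (hr : IsConnectedFiberSubmersion r) :
    IsConnectedFiberSubmersion (p ∘ r) where
  surjective := hp.surjective.comp hr.surjective
  isSubmersion :=
    (isSubmersionOfComplement_comp (by simp) hp.isSubmersion.isSubmersionOfComplement_complement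
      hr.isSubmersion.isSubmersionOfComplement_complement).isSubmersion
  isConnected_fiber y :=
    hr.isConnected_preimage (hp.isConnected_fiber y)
      (isClosed_singleton.preimage hp.contMDiff.continuous)

end IsConnectedFiberSubmersion

namespace fiberProduct

theorem isConnectedFiberSubmersion_fst (hf : ContMDiff (𝓡 X.dim) (𝓡 N.dim) ∞ f)
    (hp : IsConnectedFiberSubmersion p) :
    IsConnectedFiberSubmersion (fst hf hp.isSubmersion) where
  surjective x :=
    let ⟨m, hm⟩ := hp.surjective (f x)
    ⟨⟨(x, m), hm.symm⟩, rfl⟩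
  isSubmersion :=
    (isSubmersionOfComplement_fst
      hp.isSubmersion.isSubmersionOfComplement_complement).isSubmersion
  isConnected_fiber x := by
    have : ConnectedSpace (p ⁻¹' {f x}) := isConnected_iff_connectedSpace.1 (hp.isConnected_fiber _)
    let g : p ⁻¹' {f x} → fiberProduct hf hp.isSubmersion := fun m ↦ ⟨(x, m), m.2.symm⟩
    have hg : Continuous g :=
      IsInducing.subtypeVal.continuous_iff.2 (continuous_const.prodMk continuous_subtype_val)
    convert isConnected_range hg
    refine Subset.antisymm ?_ ?_
    · rintro q rfl
      exact ⟨⟨snd _ _ q, q.2.symm⟩, rfl⟩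
    · rintro _ ⟨m, rfl⟩
      rfl

/-- The exchange of the factors of the fiber product of two submersions. -/
def swap (hf : IsSubmersion (𝓡 X.dim) (𝓡 N.dim) ∞ f) (hp : IsSubmersion (𝓡 M.dim) (𝓡 N.dim) ∞ p) :
    fiberProduct hf.contMDiff hp
      ≃ₘ⟮𝓡 (fiberProduct hf.contMDiff hp).dim, 𝓡 (fiberProduct hp.contMDiff hf).dim⟯
      fiberProduct hp.contMDiff hf where
  toFun q := ⟨(q.1.2, q.1.1), q.2.symm⟩
  invFun q := ⟨(q.1.2, q.1.1), q.2.symm⟩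
  left_inv _ := rfl
  right_inv _ := rfl
  contMDiff_toFun := (contMDiff_iff _ _).2 ⟨contMDiff_snd _ _, contMDiff_fst _ _⟩
  contMDiff_invFun := (contMDiff_iff _ _).2 ⟨contMDiff_snd _ _, contMDiff_fst _ _⟩

theorem isConnectedFiberSubmersion_snd (hf : IsConnectedFiberSubmersion f)
    (hp : IsSubmersion (𝓡 M.dim) (𝓡 N.dim) ∞ p) :
    IsConnectedFiberSubmersion (snd hf.contMDiff hp) :=
  (isConnectedFiberSubmersion_fst hp.contMDiff hf).comp (.of_diffeomorph (swap hf.isSubmersion hp))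

end fiberProduct

end ConnectedFibers

section WeakEmbedding

variable {X Y M N : SmoothMfd.{u}} {ι : X → N} {p : M → N} {L : Set N}

namespace IsWeakEmbeddingOnto

theorem contMDiff (hι : IsWeakEmbeddingOnto ι L) : ContMDiff (𝓡 X.dim) (𝓡 N.dim) ∞ ι :=
  hι.isImmersion.contMDiff

theorem exists_lift (hι : IsWeakEmbeddingOnto ι L) {g : Y → N}
    (hg : ContMDiff (𝓡 Y.dim) (𝓡 N.dim) ∞ g) (hgL : range g ⊆ L) :
    ∃ g' : Y → X, ContMDiff (𝓡 Y.dim) (𝓡 X.dim) ∞ g' ∧ ι ∘ g' = g := by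
  obtain ⟨g', rfl⟩ : ∃ g' : Y → X, ι ∘ g' = g := by
    choose g' hg' using fun y ↦ hι.range_eq.ge (hgL (mem_range_self y))
    exact ⟨g', funext hg'⟩
  refine ⟨g', fun y ↦ ?_, rfl⟩
  let e := chartAt (EuclideanSpace ℝ (Fin Y.dim)) y
  have he : IsPartialDiffeo (𝓡 Y.dim) (𝓡 Y.dim) ∞ e := .chartAt y
  have hplot : ContMDiffOn (𝓡 Y.dim) (𝓡 X.dim) ∞ (g' ∘ e.symm) e.target :=
    (hι.plots _ _ e.open_target _).2 (hg.comp_contMDiffOn he.contMDiffOn_symm)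
  exact ((hplot.comp he.contMDiffOn e.mapsTo).congr
    fun y' hy' ↦ congrArg g' (e.left_inv hy').symm).contMDiffAt
      (e.open_source.mem_nhds (mem_chart_source _ y))

end IsWeakEmbeddingOnto

theorem fiberProduct.isWeakEmbeddingOnto_snd (hι : IsWeakEmbeddingOnto ι L)
    (hp : IsSubmersion (𝓡 M.dim) (𝓡 N.dim) ∞ p) :
    IsWeakEmbeddingOnto (snd hι.contMDiff hp) (p ⁻¹' L) where
  range_eq := by
    refine Subset.antisymm (range_subset_iff.2 fun q ↦ hι.range_eq.le ⟨_, q.2⟩) fun m hm ↦ ?_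
    obtain ⟨x, hx⟩ := hι.range_eq.ge hm
    exact ⟨⟨(x, m), hx⟩, rfl⟩
  injective q q' h :=
    Subtype.ext (Prod.ext (hι.injective ((q.2.trans (congrArg p h)).trans q'.2.symm)) h)
  isImmersion :=
    (isImmersionOfComplement_snd hι.isImmersion.isImmersionOfComplement_complement).isImmersion
  plots d U hU g := by
    refine ⟨(contMDiff_snd _ _).comp_contMDiffOn, fun h ↦
      (contMDiffOn_iff _ _).2 ⟨(hι.plots d U hU _).2 ?_, h⟩⟩
    rw [← Function.comp_assoc, comp_fst]
    exact hp.contMDiff.comp_contMDiffOn h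

theorem isConnectedWeaklyEmbedded_preimage {k : ℕ} (hL : IsConnectedWeaklyEmbedded L k)
    (hp : IsConnectedFiberSubmersion p) :
    IsConnectedWeaklyEmbedded (p ⁻¹' L) (k + (M.dim - N.dim)) := by
  obtain ⟨X, ι, rfl, hX, hι⟩ := hL
  refine ⟨fiberProduct hι.contMDiff hp.isSubmersion, _, rfl, ?_,
    fiberProduct.isWeakEmbeddingOnto_snd hι _⟩
  rw [connectedSpace_iff_univ]
  exact (fiberProduct.isConnectedFiberSubmersion_fst hι.contMDiff hp).isConnected_preimage
    isConnected_univ isClosed_univ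

end WeakEmbedding

section TangentMap

variable {𝕜 : Type*} [NontriviallyNormedField 𝕜] {E E' F H H' G : Type*}
  [NormedAddCommGroup E] [NormedSpace 𝕜 E] [NormedAddCommGroup E'] [NormedSpace 𝕜 E']
  [NormedAddCommGroup F] [NormedSpace 𝕜 F]
  [TopologicalSpace H] [TopologicalSpace H'] [TopologicalSpace G]
  {I : ModelWithCorners 𝕜 E H} {I' : ModelWithCorners 𝕜 E' H'} {J : ModelWithCorners 𝕜 F G}
  {n : WithTop ℕ∞} {M M' N : Type*} [TopologicalSpace M] [ChartedSpace H M]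
  [TopologicalSpace M'] [ChartedSpace H' M'] [TopologicalSpace N] [ChartedSpace G N]

theorem tangentMap_congr {f g : M → M'} {v : TangentBundle I M} (h : f =ᶠ[𝓝 v.proj] g) :
    tangentMap I I' f v = tangentMap I I' g v := by
  refine Bundle.TotalSpace.ext h.eq_of_nhds ?_
  simp only [tangentMap]
  rw [h.mfderiv_eq]
  rfl

namespace IsPartialDiffeo

variable {e : OpenPartialHomeomorph M M'}

theorem leftInvOn_tangentMap_symm (he : IsPartialDiffeo I I' n e) (hn : n ≠ 0) :
    LeftInvOn (tangentMap I' I e.symm) (tangentMap I I' e)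
      (Bundle.TotalSpace.proj ⁻¹' e.source) := fun v hv ↦ by
  have hinv : e.symm ∘ e =ᶠ[𝓝 v.proj] id :=
    Filter.eventuallyEq_of_mem (e.open_source.mem_nhds hv) fun m hm ↦ e.left_inv hm
  rw [← tangentMap_comp_at v ((he.symm.contMDiffAt (e.map_source hv)).mdifferentiableAt hn)
    ((he.contMDiffAt hv).mdifferentiableAt hn), tangentMap_congr hinv, tangentMap_id, id]

theorem bijOn_tangentMap (he : IsPartialDiffeo I I' n e) (hn : n ≠ 0) :
    BijOn (tangentMap I I' e) (Bundle.TotalSpace.proj ⁻¹' e.source)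
      (Bundle.TotalSpace.proj ⁻¹' e.target) :=
  InvOn.bijOn ⟨he.leftInvOn_tangentMap_symm hn, he.symm.leftInvOn_tangentMap_symm hn⟩
    (fun _ hv ↦ e.map_source hv) fun _ hv ↦ e.map_target hv

end IsPartialDiffeo

theorem tangentMap_prodMap_id {f : M → M'} {w : TangentBundle I M}
    (hf : MDifferentiableAt I I' f w.proj) {u : TangentBundle (I'.prod J) (M' × N)}
    (h : tangentMap I I' f w = tangentMap (I'.prod J) I' Prod.fst u) :
    tangentMap (I.prod J) (I'.prod J) (Prod.map f id) ⟨(w.proj, u.proj.2), (w.2, u.2.2)⟩ = u := by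
  obtain ⟨⟨y, s⟩, ⟨η, σ⟩⟩ := u
  rw [tangentMap_prodFst] at h
  cases h
  refine Bundle.TotalSpace.ext rfl (heq_of_eq ?_)
  simp only [tangentMap]
  rw [mfderiv_prodMap hf mdifferentiableAt_id, mfderiv_id]
  rfl

end TangentMap

section TangentDistribution

variable {X M N : SmoothMfd.{u}} {f : X → N} {p : M → N}

theorem fiberProduct.mem_range_tangentMap_snd {hf : ContMDiff (𝓡 X.dim) (𝓡 N.dim) ∞ f}
    {hp : IsSubmersion (𝓡 M.dim) (𝓡 N.dim) ∞ p} {v : TangentBundle (𝓡 M.dim) M}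
    (hv : tangentMap (𝓡 M.dim) (𝓡 N.dim) p v ∈ range (tangentMap (𝓡 X.dim) (𝓡 N.dim) f)) :
    v ∈ range (tangentMap (𝓡 (fiberProduct hf hp).dim) (𝓡 M.dim) (snd hf hp)) := by
  obtain ⟨w, hw⟩ := hv
  obtain ⟨e, he, hve⟩ := exists_isProductChart (isSubmersionOfComplement_euclideanSpace hp v.proj)
  let q : fiberProduct hf hp := ⟨(w.proj, v.proj), congrArg Bundle.TotalSpace.proj hw⟩
  obtain ⟨b, hb, hqb, hbe, heq⟩ := exists_isProductChart_fst he (q := q) hve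
  let u := tangentMap (𝓡 M.dim)
    ((𝓡 N.dim).prod 𝓘(ℝ, EuclideanSpace ℝ (Fin (M.dim - N.dim)))) e v
  let a : TangentBundle ((𝓡 X.dim).prod 𝓘(ℝ, EuclideanSpace ℝ (Fin (M.dim - N.dim)))) _ :=
    ⟨(w.proj, u.proj.2), (w.2, u.2.2)⟩
  have ha : a.proj = b q := Prod.ext (hb.fst_apply q hqb).symm (Prod.ext_iff.1 (heq hqb)).2
  have hau : tangentMap _ _ (Prod.map f id) a = u := by
    refine tangentMap_prodMap_id (hf.mdifferentiableAt (by simp)) ?_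
    rw [hw, tangentMap_congr (he.eventuallyEq hve), tangentMap_comp_at _ mdifferentiableAt_fst
      ((he.isPartialDiffeo.contMDiffAt hve).mdifferentiableAt (by simp))]
  obtain ⟨z, hz, hza⟩ := (hb.isPartialDiffeo.bijOn_tangentMap (by simp)).surjOn
    (show a.proj ∈ b.target from ha ▸ b.map_source hqb)
  refine ⟨z, (he.isPartialDiffeo.bijOn_tangentMap (by simp)).injOn (hbe hz) hve ?_⟩
  rw [← tangentMap_comp_at z
      ((he.isPartialDiffeo.contMDiffAt (hbe hz)).mdifferentiableAt (by simp))
      ((contMDiff_snd hf hp).mdifferentiableAt (by simp)),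
    tangentMap_congr (heq.eventuallyEq_of_mem (b.open_source.mem_nhds hz)),
    tangentMap_comp_at z ((hf.prodMap contMDiff_id).mdifferentiableAt (by simp))
      ((hb.isPartialDiffeo.contMDiffAt hz).mdifferentiableAt (by simp)), hza, hau]

end TangentDistribution

section FoliatedChart

variable {N A B A' B' : Type*} [TopologicalSpace N] [TopologicalSpace A] [TopologicalSpace B]
  [TopologicalSpace A'] [TopologicalSpace B'] {leaves : Set (Set N)}
  {ψ : OpenPartialHomeomorph N (A × B)}

/-- A chart with values in a product `A × B` in which membership of a point in any given leaf
depends only on its `B`-coordinate. This is the part of `HasAdaptedChart` which does not depend on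
the choice of a center and of the shape of the target. -/
def IsFoliatedChart (leaves : Set (Set N)) (ψ : OpenPartialHomeomorph N (A × B)) : Prop :=
  ∀ L ∈ leaves, ∃ ℓ : Set B, ∀ y ∈ ψ.source, y ∈ L ↔ (ψ y).2 ∈ ℓ

theorem IsFoliatedChart.trans_prod (h : IsFoliatedChart leaves ψ) (α : OpenPartialHomeomorph A A')
    (β : OpenPartialHomeomorph B B') : IsFoliatedChart leaves (ψ.trans (α.prod β)) := fun L hL ↦ by
  obtain ⟨ℓ, hℓ⟩ := h L hL
  refine ⟨β.symm ⁻¹' ℓ, fun y hy ↦ ?_⟩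
  have hβ : β.symm (β (ψ y).2) = (ψ y).2 := β.left_inv hy.2.2
  simp [hℓ y hy.1, hβ]

end FoliatedChart

section AdaptedChart

variable {M N : SmoothMfd.{u}} {p : M → N}

theorem HasAdaptedChart.exists_isFoliatedChart {leaves : Set (Set M)} {k : ℕ} {x : M}
    (h : HasAdaptedChart leaves k x) :
    ∃ (l : ℕ) (ψ : OpenPartialHomeomorph M (EuclideanSpace ℝ (Fin k) × EuclideanSpace ℝ (Fin l))),
      IsPartialDiffeo (𝓡 M.dim) ((𝓡 k).prod (𝓡 l)) ∞ ψ ∧ IsFoliatedChart leaves ψ ∧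
      x ∈ ψ.source := by
  obtain ⟨l, -, ψ, U, W, hψ, hψ', -, -, hUW, hx, -, hleaf⟩ := h
  refine ⟨l, ψ, .iff_modelWithCornersSelf_prod.2 ⟨hψ, hψ'⟩, fun L hL ↦ ?_, hx⟩
  obtain ⟨ℓ, -, hℓ⟩ := hleaf L hL
  refine ⟨ℓ, fun y hy ↦ ⟨fun hyL ↦ (hℓ.le (mem_image_of_mem ψ ⟨hyL, hy⟩)).2, fun hyℓ ↦ ?_⟩⟩
  have hyU : (ψ y).1 ∈ U := (hUW.le (ψ.map_source hy)).1
  obtain ⟨y', ⟨hyL', hy'⟩, hyy'⟩ := hℓ.ge (mk_mem_prod hyU hyℓ)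
  exact ψ.injOn hy' hy hyy' ▸ hyL'

theorem IsFoliatedChart.hasAdaptedChart_of_apply_eq_zero {leaves : Set (Set M)} {k l : ℕ}
    {ψ : OpenPartialHomeomorph M (EuclideanSpace ℝ (Fin k) × EuclideanSpace ℝ (Fin l))}
    (h : IsFoliatedChart leaves ψ) (hψ : IsPartialDiffeo (𝓡 M.dim) ((𝓡 k).prod (𝓡 l)) ∞ ψ) {x : M}
    (hx : x ∈ ψ.source) (hx₀ : ψ x = (0, 0)) : HasAdaptedChart leaves k x := by
  obtain ⟨L⟩ := hψ.nonempty_continuousLinearEquiv (by simp) hx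
  obtain ⟨U, W, hU, hW, h0U, h0W, hUW⟩ :=
    isOpen_prod_iff.1 ψ.open_target 0 0 (hx₀ ▸ ψ.map_source hx)
  let ψ' := (ψ.symm.restrOpen (U ×ˢ W) (hU.prod hW)).symm
  obtain ⟨hψ₁, hψ₂⟩ :=
    IsPartialDiffeo.iff_modelWithCornersSelf_prod.1 (hψ.symm.restrOpen (hU.prod hW)).symm
  have htarget : ψ'.target = U ×ˢ W := inter_eq_right.2 hUW
  refine ⟨l, by simpa using L.toLinearEquiv.finrank_eq.symm, ψ', U, W, hψ₁, hψ₂, hU, hW, htarget,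
    ⟨hx, ?_⟩, hx₀, fun S hS ↦ ?_⟩
  · change ψ x ∈ U ×ˢ W
    exact hx₀ ▸ ⟨h0U, h0W⟩
  · obtain ⟨ℓ, hℓ⟩ := h S hS
    have hmem : ∀ z ∈ U ×ˢ W, ψ.symm z ∈ S ↔ z.2 ∈ ℓ := fun z hz ↦ by
      rw [hℓ _ (ψ.map_target (hUW hz)), ψ.right_inv (hUW hz)]
    refine ⟨ℓ ∩ W, inter_subset_right, ?_⟩
    rw [inter_comm, ψ'.image_source_inter_eq', htarget]
    ext z
    refine ⟨fun hz ↦ ⟨hz.1.1, (hmem z hz.1).1 hz.2, hz.1.2⟩, fun hz ↦ ?_⟩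
    have hz' : z ∈ U ×ˢ W := ⟨hz.1, hz.2.2⟩
    exact ⟨hz', (hmem z hz').2 hz.2.1⟩

theorem exists_isPartialDiffeo_apply_eq_zero {A : Type*} [NormedAddCommGroup A] [NormedSpace ℝ A]
    [FiniteDimensional ℝ A] (a : A) :
    ∃ α : OpenPartialHomeomorph A (EuclideanSpace ℝ (Fin (Module.finrank ℝ A))),
      IsPartialDiffeo 𝓘(ℝ, A) (𝓡 (Module.finrank ℝ A)) ∞ α ∧ a ∈ α.source ∧ α a = 0 := by
  let L : A ≃L[ℝ] EuclideanSpace ℝ (Fin (Module.finrank ℝ A)) := .ofFinrankEq (by simp)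
  let τ : A ≃ₘ⟮𝓘(ℝ, A), 𝓘(ℝ, A)⟯ A :=
    { toEquiv := Equiv.subRight a
      contMDiff_toFun := (contDiff_id.sub contDiff_const).contMDiff
      contMDiff_invFun := (contDiff_id.add contDiff_const).contMDiff }
  exact ⟨_, (IsPartialDiffeo.of_diffeomorph τ).trans (.of_continuousLinearEquiv L),
    by simp, (congrArg L (sub_self a)).trans (map_zero L)⟩

theorem IsFoliatedChart.hasAdaptedChart {A B : Type*} [NormedAddCommGroup A] [NormedSpace ℝ A]
    [FiniteDimensional ℝ A] [NormedAddCommGroup B] [NormedSpace ℝ B] [FiniteDimensional ℝ B]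
    {leaves : Set (Set M)} {ψ : OpenPartialHomeomorph M (A × B)} (h : IsFoliatedChart leaves ψ)
    (hψ : IsPartialDiffeo (𝓡 M.dim) (𝓘(ℝ, A).prod 𝓘(ℝ, B)) ∞ ψ) {x : M} (hx : x ∈ ψ.source) :
    HasAdaptedChart leaves (Module.finrank ℝ A) x := by
  obtain ⟨α, hα, hxα, hα₀⟩ := exists_isPartialDiffeo_apply_eq_zero (ψ x).1
  obtain ⟨β, hβ, hxβ, hβ₀⟩ := exists_isPartialDiffeo_apply_eq_zero (ψ x).2
  exact (h.trans_prod α β).hasAdaptedChart_of_apply_eq_zero (hψ.trans (hα.prod hβ))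
    ⟨hx, hxα, hxβ⟩ (Prod.ext hα₀ hβ₀)

theorem IsFoliatedChart.preimage {A B F : Type*} [NormedAddCommGroup A] [NormedSpace ℝ A]
    [NormedAddCommGroup B] [NormedSpace ℝ B] [NormedAddCommGroup F] [NormedSpace ℝ F]
    {leaves : Set (Set N)} {ψ : OpenPartialHomeomorph N (A × B)} (h : IsFoliatedChart leaves ψ)
    {e : OpenPartialHomeomorph M (N × F)} (he : IsProductChart (𝓡 M.dim) (𝓡 N.dim) ∞ p e) :
    IsFoliatedChart {S | ∃ L ∈ leaves, S = p ⁻¹' L} ((e.trans (ψ.prod (.refl F))).trans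
      (prodRightComm ℝ A B F).toHomeomorph.toOpenPartialHomeomorph) := by
  rintro _ ⟨L, hL, rfl⟩
  obtain ⟨ℓ, hℓ⟩ := h L hL
  refine ⟨ℓ, fun m hm ↦ ?_⟩
  have hm' : m ∈ e.source ∧ (e m).1 ∈ ψ.source := by simpa using hm
  rw [mem_preimage, ← he.fst_apply m hm'.1, hℓ _ hm'.2]
  rfl

theorem HasAdaptedChart.preimage {leaves : Set (Set N)} {k : ℕ} {m : M}
    (h : HasAdaptedChart leaves k (p m)) (hp : IsSubmersion (𝓡 M.dim) (𝓡 N.dim) ∞ p) :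
    HasAdaptedChart {S | ∃ L ∈ leaves, S = p ⁻¹' L} (k + (M.dim - N.dim)) m := by
  obtain ⟨l, ψ, hψ, hleaves, hpm⟩ := h.exists_isFoliatedChart
  obtain ⟨e, he, hm⟩ := exists_isProductChart (isSubmersionOfComplement_euclideanSpace hp m)
  have hΘ := (hleaves.preimage he).hasAdaptedChart (x := m)
    ((he.isPartialDiffeo.trans (hψ.prod .refl)).trans .prodRightComm)
    (by simpa [hm, he.fst_apply m hm] using hpm)
  simpa using hΘ

end AdaptedChart

section Pullback

variable {P M N : SmoothMfd.{u}} {r : P → M} {p : M → N}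

theorem IsPullback.of_leaves_eq {F : SingularFoliation M} {G : SingularFoliation N}
    (hp : IsSubmersion (𝓡 M.dim) (𝓡 N.dim) ∞ p)
    (hF : F.leaves = {S | ∃ L ∈ G.leaves, S = p ⁻¹' L}) : IsPullback p G F where
  leaves_eq := hF
  tangentDistribution_eq := by
    have mdifferentiable {A B : SmoothMfd.{u}} {h : A → B}
        (hh : ContMDiff (𝓡 A.dim) (𝓡 B.dim) ∞ h) : MDifferentiable (𝓡 A.dim) (𝓡 B.dim) h :=
      hh.mdifferentiable (by simp)
    refine Subset.antisymm ?_ ?_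
    · rintro _ ⟨S, hS, Y, κ, hκ, w, rfl⟩
      obtain ⟨L, hL, rfl⟩ := hF.le hS
      obtain ⟨k, ⟨X, ι, -, -, hι⟩, -⟩ := G.isLeaf L hL
      have hκL : range (p ∘ κ) ⊆ L := range_subset_iff.2 fun y ↦ hκ.range_eq.le (mem_range_self y)
      obtain ⟨g, hg, hgκ⟩ := hι.exists_lift (hp.contMDiff.comp hκ.contMDiff) hκL
      have hT : tangentMap (𝓡 X.dim) (𝓡 N.dim) ι ∘ tangentMap (𝓡 Y.dim) (𝓡 X.dim) g =
          tangentMap (𝓡 M.dim) (𝓡 N.dim) p ∘ tangentMap (𝓡 Y.dim) (𝓡 M.dim) κ := by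
        rw [← tangentMap_comp (mdifferentiable hι.contMDiff) (mdifferentiable hg), hgκ,
          tangentMap_comp (mdifferentiable hp.contMDiff) (mdifferentiable hκ.contMDiff)]
      exact ⟨L, hL, X, ι, hι, tangentMap _ _ g w, congrFun hT w⟩
    · rintro v ⟨L, hL, X, ι, hι, hv⟩
      exact ⟨p ⁻¹' L, hF.ge ⟨L, hL, rfl⟩, _, _, fiberProduct.isWeakEmbeddingOnto_snd hι hp,
        fiberProduct.mem_range_tangentMap_snd hv⟩

/-- The pullback of a singular foliation along a surjective submersion with connected fibers, with
leaves the preimages of the leaves. -/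
def pullbackFoliation (hp : IsConnectedFiberSubmersion p) (G : SingularFoliation N) :
    SingularFoliation M where
  leaves := {S | ∃ L ∈ G.leaves, S = p ⁻¹' L}
  isPartition := by
    refine ⟨?_, fun m ↦ ?_⟩
    · rintro ⟨L, hL, hempty⟩
      exact ((Setoid.nonempty_of_mem_partition G.isPartition hL).preimage hp.surjective).ne_empty
        hempty.symm
    · obtain ⟨L, ⟨hL, hm⟩, huniq⟩ := G.isPartition.2 (p m)
      refine ⟨p ⁻¹' L, ⟨⟨L, hL, rfl⟩, hm⟩, ?_⟩
      rintro _ ⟨⟨L', hL', rfl⟩, hm'⟩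
      rw [huniq L' ⟨hL', hm'⟩]
  isLeaf := by
    rintro _ ⟨L, hL, rfl⟩
    obtain ⟨k, hk, hchart⟩ := G.isLeaf L hL
    exact ⟨k + (M.dim - N.dim), isConnectedWeaklyEmbedded_preimage hk hp,
      fun m hm ↦ (hchart (p m) hm).preimage hp.isSubmersion⟩

theorem isPullback_pullbackFoliation (hp : IsConnectedFiberSubmersion p)
    (G : SingularFoliation N) : IsPullback p G (pullbackFoliation hp G) :=
  .of_leaves_eq hp.isSubmersion rfl

protected theorem IsPullback.id (F : SingularFoliation M) : IsPullback id F F where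
  tangentDistribution_eq := by rw [tangentMap_id, preimage_id]
  leaves_eq := by simp

theorem IsPullback.comp_iff {F : SingularFoliation P} {G : SingularFoliation M}
    {H : SingularFoliation N} (hG : IsPullback p H G) (hp : IsConnectedFiberSubmersion p)
    (hr : IsConnectedFiberSubmersion r) : IsPullback (p ∘ r) H F ↔ IsPullback r G F := by
  have htangent : tangentMap (𝓡 P.dim) (𝓡 N.dim) (p ∘ r) ⁻¹' H.tangentDistribution =
      tangentMap (𝓡 P.dim) (𝓡 M.dim) r ⁻¹' G.tangentDistribution := by
    rw [tangentMap_comp (hp.contMDiff.mdifferentiable (by simp))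
      (hr.contMDiff.mdifferentiable (by simp)), preimage_comp, hG.tangentDistribution_eq]
  have hleaves : {S | ∃ L ∈ H.leaves, S = p ∘ r ⁻¹' L} = {S | ∃ L ∈ G.leaves, S = r ⁻¹' L} := by
    rw [hG.leaves_eq]
    ext S
    refine ⟨?_, ?_⟩
    · rintro ⟨L, hL, rfl⟩
      exact ⟨_, ⟨L, hL, rfl⟩, rfl⟩
    · rintro ⟨_, ⟨L, hL, rfl⟩, rfl⟩
      exact ⟨L, hL, rfl⟩
  exact ⟨fun h ↦ ⟨h.1.trans htangent, h.2.trans hleaves⟩,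
    fun h ↦ ⟨h.1.trans htangent.symm, h.2.trans hleaves.symm⟩⟩

end Pullback

namespace MolinoTransverseEquivalent

variable {A B C : FoliatedMfd.{u}}

protected theorem refl (A : FoliatedMfd.{u}) : MolinoTransverseEquivalent A A :=
  ⟨A, id, id, .id, .id, .id _, .id _⟩

protected theorem symm (h : MolinoTransverseEquivalent A B) : MolinoTransverseEquivalent B A :=
  let ⟨M, p, q, hp, hq, hpM, hqM⟩ := h
  ⟨M, q, p, hq, hp, hqM, hpM⟩

protected theorem trans (hAB : MolinoTransverseEquivalent A B)
    (hBC : MolinoTransverseEquivalent B C) : MolinoTransverseEquivalent A C := by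
  obtain ⟨M, p, q, hp, hq, hpM, hqM⟩ := hAB
  obtain ⟨M', p', q', hp', hq', hpM', hqM'⟩ := hBC
  have h₁ := fiberProduct.isConnectedFiberSubmersion_fst hq.contMDiff hp'
  have h₂ := fiberProduct.isConnectedFiberSubmersion_snd hq hp'.isSubmersion
  have hF := isPullback_pullbackFoliation h₁ M.foliation
  have hF' := (hqM.comp_iff hq h₁).2 hF
  rw [fiberProduct.comp_fst, hpM'.comp_iff hp' h₂] at hF'
  exact ⟨⟨_, _⟩, _, _, hp.comp h₁, hq'.comp h₂, (hpM.comp_iff hp h₁).2 hF,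
    (hqM'.comp_iff hq' h₂).2 hF'⟩

end MolinoTransverseEquivalent

end SingularFol

theorem proposition5 :
    Equivalence
      (SingularFol.MolinoTransverseEquivalent.{u} :
        SingularFol.FoliatedMfd.{u} → SingularFol.FoliatedMfd.{u} → Prop) :=
  ⟨.refl, .symm, .trans⟩
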